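/- \textbf{Definitions.} Let $G\colon \mathbf{Set}\to\mathbf{Set}$ be a functor. Its category of elements $\mathrm{El}(G)$ has as objects the pairs $(X,x)$ with $x\in G(X)$, and as morphisms $(X,x)\to(Y,y)$ the maps $f\colon X\to Y$ with $G(f)(x)=y$. An object $X$ of a category is \emph{transitive} if, for every object $A$, $\mathrm{Hom}(X,A)$ is non-empty and $\mathrm{Aut}(X)$ acts transitively on it by composition. A \emph{weak normal form} of an object $A$ of a category $\mathcal C$ is a transitive object of the slice category $\mathcal C/A$. The functor $G$ is \emph{analytic} if every object of $\mathrm{El}(G)$ has a weak normal form and, for every weak normal form $f\colon (Y,y)\to(X,x)$ in $\mathrm{El}(G)$, the set $Y$ is finite. The \emph{support} of $x\in G(X)$ is then $\mathrm{supp}(x)=f(Y)\subseteq X$, where $f\colon (Y,y)\to (X,x)$ is any weak normal form of $(X,x)$ (it does not depend on the choice of $f$). Let $(\mu G,\delta)$, $\delta\colon G(\mu G)\to\mu G$, be an initial algebra of $G$. The \emph{substructure ordering} $\sqsubseteq$ on $\mu G$ is the transitive closure of the relation ``$a=b$ or $a\in\mathrm{supp}(\delta^{-1}(b))$''; for $S\subseteq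 \mu G$ write ${\uparrow}_{\sqsubseteq}S=\{b : a\sqsubseteq b \text{ for some } a\in S\}$. A functor $T\colon\mathbf{Top}\to\mathbf{Top}$ is a \emph{lift} of $G$ if $U\circ T= G\circ U$ (possibly up to a fixed natural isomorphism), where $U\colon\mathbf{Top}\to\mathbf{Set}$ is the forgetful functor. A topological space is \emph{Noetherian} if all of its subsets are compact. \textbf{Theorem.} Let $T\colon\mathbf{Top}\to\mathbf{Top}$ be a lift of an analytic functor $G\colon\mathbf{Set}\to\mathbf{Set}$, and assume that $T$ maps topological embeddings to topological embeddings and Noetherian spaces to Noetherian spaces. Let $(\mu G,\delta)$ be an initial algebra of $G$. For a topology $\tau$ on $\mu G$, let $E(\tau)$ be the topology on $\mu G$ generated by the sets ${\uparrow}_{\sqsubseteq}\,\delta(V)$, where $V$ ranges over the open subsets of $T(\mu G,\tau)$. Then $E$ has a least fixed point with respect to inclusion of topologies (the \emph{divisibility topology} on $\mu G$), and this topology is Noetherian. -/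

import Mathlib

open CategoryTheory
open scoped Topology

universe u v w

/-- A transitive object: every `Hom(X, A)` is non-empty, and `Aut(X)` acts transitively on it
by composition. -/
def IsTransitiveObject {C : Type v} [Category.{w} C] (X : C) : Prop :=
  ∀ A : C, Nonempty (X ⟶ A) ∧ ∀ f g : X ⟶ A, ∃ σ : Aut X, σ.hom ≫ f = g

/-- A weak normal form of `A`: a transitive object of the slice category over `A`. -/
def IsWeakNormalForm {C : Type v} [Category.{w} C] {A : C} (f : Over A) : Prop :=
  IsTransitiveObject f

/-- Analytic functors: every object of the category of elements has a weak normal form, and the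
underlying set of (the domain of) any weak normal form is finite. -/
def IsAnalyticFunctor (G : Type u ⥤ Type u) : Prop :=
  (∀ A : G.Elements, ∃ f : Over A, IsWeakNormalForm f) ∧
    ∀ (A : G.Elements) (f : Over A), IsWeakNormalForm f → Finite f.left.1

/-- The support of `x ∈ G(X)`: the image `f(Y) ⊆ X` of a weak normal form
`f : (Y, y) ⟶ (X, x)` in the category of elements. Any two weak normal forms of the same object
are isomorphic over it, so this image does not depend on the choice of `f`. -/
def elementSupport (G : Type u ⥤ Type u) {X : Type u} (x : G.obj X) : Set X :=
  {a | ∃ f : Over (G.elementsMk X x), IsWeakNormalForm f ∧ a ∈ Set.range f.hom.val}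

/-- `a` is a child of `b` in the algebra `(A, δ)`: `a = b`, or `a` is in the support of
`δ⁻¹(b)`. -/
def IsChild (G : Type u ⥤ Type u) (A : Endofunctor.Algebra G) (a b : A.a) : Prop :=
  a = b ∨ ∃ x ∈ A.str ⁻¹' {b}, a ∈ elementSupport G x

/-- The substructure ordering `⊑`: the transitive closure of the child relation. -/
def Substructure (G : Type u ⥤ Type u) (A : Endofunctor.Algebra G) : A.a → A.a → Prop :=
  Relation.TransGen (IsChild G A)

/-- The upward closure of a set for the substructure ordering. -/
def substructureUp (G : Type u ⥤ Type u) (A : Endofunctor.Algebra G) (S : Set A.a) : Set A.a :=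
  {b | ∃ a ∈ S, Substructure G A a b}

/-- `T` is a lift to topological spaces of the endofunctor `G` of sets: the square formed with the
forgetful functor commutes, up to a given natural isomorphism (an equality of functors gives
such an isomorphism through `eqToIso`). -/
abbrev TopLift (T : TopCat.{u} ⥤ TopCat.{u}) (G : Type u ⥤ Type u) : Type (u + 1) :=
  T ⋙ forget TopCat.{u} ≅ forget TopCat.{u} ⋙ G

/-- `T` preserves topological embeddings. -/
def PreservesEmbeddings (T : TopCat.{u} ⥤ TopCat.{u}) : Prop :=
  ∀ ⦃X Y : TopCat.{u}⦄ (f : X ⟶ Y), Topology.IsEmbedding f → Topology.IsEmbedding (T.map f)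

/-- `T` preserves Noetherian spaces. -/
def PreservesNoetherian (T : TopCat.{u} ⥤ TopCat.{u}) : Prop :=
  ∀ X : TopCat.{u}, TopologicalSpace.NoetherianSpace X →
    TopologicalSpace.NoetherianSpace (T.obj X)

/-- The set `δ(U)`, for a subset `U` of the underlying set of `T(A, τ)`, which the lift identifies
with `G(A)`. -/
def strImage {T : TopCat.{u} ⥤ TopCat.{u}} {G : Type u ⥤ Type u} (e : TopLift T G)
    (A : Endofunctor.Algebra G) (τ : TopologicalSpace A.a)
    (U : Set (T.obj (@TopCat.of A.a τ))) : Set A.a :=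
  (fun t : T.obj (@TopCat.of A.a τ) => A.str (e.hom.app (@TopCat.of A.a τ) t)) '' U

/-- The map sending `τ` to the topology generated by the sets `↑_⊑ δ(U)`, for `U` open in
`T(A, τ)`. -/
@[reducible]
def divExp {T : TopCat.{u} ⥤ TopCat.{u}} {G : Type u ⥤ Type u} (e : TopLift T G)
    (A : Endofunctor.Algebra G) (τ : TopologicalSpace A.a) : TopologicalSpace A.a :=
  TopologicalSpace.generateFrom
    {V | ∃ U : Set (T.obj (@TopCat.of A.a τ)),
      IsOpen U ∧ V = substructureUp G A (strImage e A τ U)}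

theorem divExp_monotone {T : TopCat.{u} ⥤ TopCat.{u}} {G : Type u ⥤ Type u} (e : TopLift T G)
    (A : Endofunctor.Algebra G) : Monotone (divExp e A) := by
  intro σ τ h
  refine le_generateFrom ?_
  rintro V ⟨U, hU, rfl⟩
  let i : @TopCat.of A.a σ ⟶ @TopCat.of A.a τ :=
    @TopCat.ofHom A.a A.a σ τ (@ContinuousMap.mk A.a A.a σ τ id (continuous_id_iff_le.2 h))
  have hi : (forget TopCat.{u}).map i = 𝟙 A.a := rfl
  have key : ∀ t : T.obj (@TopCat.of A.a σ),
      e.hom.app (@TopCat.of A.a τ) (T.map i t) = e.hom.app (@TopCat.of A.a σ) t := by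
    intro t
    have h1 := ConcreteCategory.congr_hom (e.hom.naturality i) t
    have h2 : (forget TopCat.{u} ⋙ G).map i = 𝟙 (G.obj A.a) := by
      change G.map ((forget TopCat.{u}).map i) = _
      rw [hi, G.map_id]
    rw [h2] at h1
    exact h1
  have inj : Function.Injective (e.hom.app (@TopCat.of A.a τ)) := by
    rw [← mono_iff_injective]
    infer_instance
  have surj : Function.Surjective (e.hom.app (@TopCat.of A.a σ)) := by
    rw [← epi_iff_surjective]
    infer_instance
  refine TopologicalSpace.isOpen_generateFrom_of_mem
    ⟨T.map i ⁻¹' U, hU.preimage (T.map i).hom.continuous, ?_⟩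
  congr 1
  ext b
  constructor
  · rintro ⟨t, ht, rfl⟩
    obtain ⟨s, hs⟩ := surj (e.hom.app (@TopCat.of A.a τ) t)
    have hst : T.map i s = t := inj ((key s).trans hs)
    exact ⟨s, by rw [Set.mem_preimage, hst]; exact ht, congrArg A.str hs⟩
  · rintro ⟨s, hs, rfl⟩
    exact ⟨T.map i s, hs, congrArg A.str (key s)⟩

/-- The divisibility topology: the least fixed point of `divExp`, where topologies are ordered by
inclusion of their families of open sets. In Mathlib's order on topologies `σ ≤ τ` means that `σ`
has more open sets than `τ`, hence `gfp`. -/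
@[reducible]
def divisibilityTopology {T : TopCat.{u} ⥤ TopCat.{u}} {G : Type u ⥤ Type u} (e : TopLift T G)
    (A : Endofunctor.Algebra G) : TopologicalSpace A.a :=
  OrderHom.gfp ⟨divExp e A, divExp_monotone e A⟩

/-!
A topology generated by a subbasis fails to be Noetherian exactly when the subbasis contains a bad
sequence, that is, a sequence of sets none of which is covered by its predecessors. Iterating
`divExp` transfinitely from the coarsest topology, rank each subbasic set by the stage at which it
appears. If some bad sequence existed, a Nash-Williams argument would give one, `W`, whose ranks are
lexicographically minimal; by minimality, the sets of smaller rank than `W n`, restricted to the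
complement `H n` of `W 0 ∪ ⋯ ∪ W (n - 1)`, for all `n`, generate a Noetherian topology `θ`. On
`H n`, `θ` refines the stage from which `W n` was built. As `H n` is downward closed for `⊑`, every
element of `G(A)` that `δ` sends into `H n` has its support in `H n`, so it comes from `G (H n)`;
since `T` preserves embeddings, `W n` agrees on `H n` with a subbasic set of `divExp θ`. These sets
form a bad sequence, although `divExp θ` is Noetherian because `T` preserves Noetherian spaces.
-/

section BadSequences

variable {X : Type*}

/-- The points not covered by the first `n` sets of the sequence `W`. -/
def uncovered (W : ℕ → Set X) (n : ℕ) : Set X :=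
  {x | ∀ i < n, x ∉ W i}

/-- Bad sequences of sets: no set of the sequence is covered by the previous ones. -/
def IsBadSeq (W : ℕ → Set X) : Prop :=
  ∀ n, (W n ∩ uncovered W n).Nonempty

theorem uncovered_antitone (W : ℕ → Set X) : Antitone (uncovered W) :=
  fun _ _ hmn _ hx i hi => hx i (hi.trans_le hmn)

theorem uncovered_congr {W W' : ℕ → Set X} {n : ℕ} (h : ∀ i < n, W i = W' i) :
    uncovered W n = uncovered W' n := by
  ext x
  exact forall₂_congr fun i hi => by rw [h i hi]

theorem isClosed_uncovered [TopologicalSpace X] {W : ℕ → Set X} (hW : ∀ n, IsOpen (W n)) (n : ℕ) :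
    IsClosed (uncovered W n) := by
  have h : uncovered W n = ⋂ i ∈ Set.Iio n, (W i)ᶜ := by ext x; simp [uncovered]
  rw [h]
  exact isClosed_biInter fun i _ => (hW i).isClosed_compl

theorem IsBadSeq.comp_strictMono {W : ℕ → Set X} (hW : IsBadSeq W) {φ : ℕ → ℕ}
    (hφ : StrictMono φ) : IsBadSeq (W ∘ φ) := fun n =>
  let ⟨x, hx, hxφ⟩ := hW (φ n)
  ⟨x, hx, fun i hi => hxφ (φ i) (hφ hi)⟩

theorem exists_isBadSeq_of_no_finite_subcover {P : Set (Set X)} {s : Set X} (hs : s ⊆ ⋃₀ P)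
    (hP : ∀ Q ⊆ P, Q.Finite → ¬ s ⊆ ⋃₀ Q) : ∃ W : ℕ → Set X, (∀ n, W n ∈ P) ∧ IsBadSeq W := by
  obtain ⟨f, hf, hlt⟩ := exists_seq_of_forall_finset_exists
    (fun p : Set X × X => p.1 ∈ P ∧ p.2 ∈ p.1) (fun p q => q.2 ∉ p.1) fun F hF => by
      have hFP : Prod.fst '' (F : Set (Set X × X)) ⊆ P := by
        rintro _ ⟨p, hp, rfl⟩
        exact (hF p hp).1
      obtain ⟨x, hxs, hxF⟩ := Set.not_subset.1 (hP _ hFP (F.finite_toSet.image _))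
      obtain ⟨U, hU, hxU⟩ := hs hxs
      exact ⟨(U, x), ⟨hU, hxU⟩, fun p hp hxp => hxF ⟨p.1, ⟨p, hp, rfl⟩, hxp⟩⟩
  exact ⟨fun n => (f n).1, fun n => (hf n).1, fun n => ⟨(f n).2, (hf n).2, fun i => hlt i n⟩⟩

theorem not_isBadSeq_of_isOpen [TopologicalSpace X] [TopologicalSpace.NoetherianSpace X]
    {W : ℕ → Set X} (hW : ∀ n, IsOpen (W n)) : ¬ IsBadSeq W := by
  intro hbad
  obtain ⟨t, ht⟩ := (TopologicalSpace.NoetherianSpace.isCompact (⋃ n, W n)).elim_finite_subcover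
    W hW subset_rfl
  obtain ⟨N, hN⟩ := t.exists_nat_subset_range
  obtain ⟨x, hx, hxN⟩ := hbad N
  obtain ⟨i, hi, hxi⟩ := Set.mem_iUnion₂.1 (ht (Set.mem_iUnion.2 ⟨N, hx⟩))
  exact hxN i (Finset.mem_range.1 (hN hi)) hxi

theorem noetherianSpace_generateFrom_iff {S : Set (Set X)} :
    @TopologicalSpace.NoetherianSpace X (TopologicalSpace.generateFrom S) ↔
      ∀ W : ℕ → Set X, (∀ n, W n ∈ S) → ¬ IsBadSeq W := by
  let _ := TopologicalSpace.generateFrom S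
  refine ⟨fun _ W hW => not_isBadSeq_of_isOpen fun n =>
    TopologicalSpace.isOpen_generateFrom_of_mem (hW n), fun hS => ?_⟩
  refine TopologicalSpace.noetherianSpace_iff_isCompact.2 fun s =>
    isCompact_generateFrom rfl fun P hPS hs => ?_
  by_contra! hP
  obtain ⟨W, hWP, hW⟩ := exists_isBadSeq_of_no_finite_subcover hs hP
  exact hS W (fun n => hPS (hWP n)) hW

theorem induced_subtypeVal_generateFrom_le {C D : Set (Set X)} {H : Set X}
    (hCD : ∀ U ∈ C, U ∩ H ∈ D) :
    (TopologicalSpace.generateFrom D).induced (Subtype.val : H → X) ≤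
      (TopologicalSpace.generateFrom C).induced Subtype.val := by
  rw [induced_generateFrom_eq (b := C)]
  refine le_generateFrom ?_
  rintro _ ⟨U, hU, rfl⟩
  exact ⟨U ∩ H, TopologicalSpace.isOpen_generateFrom_of_mem (hCD U hU),
    by rw [Set.preimage_inter, Subtype.coe_preimage_self, Set.inter_univ]⟩

end BadSequences

section MinimalBadSequences

variable {α ι X : Type*}

/-- The first `m` terms of `f`, followed by the sequence `g`. -/
def splice (m : ℕ) (f g : ℕ → α) (k : ℕ) : α :=
  if k < m then f k else g (k - m)

theorem splice_of_lt {m k : ℕ} (f g : ℕ → α) (hk : k < m) : splice m f g k = f k :=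
  if_pos hk

theorem splice_add (m k : ℕ) (f g : ℕ → α) : splice m f g (m + k) = g k := by
  simp [splice]

theorem forall_splice {p : α → Prop} {m : ℕ} {f g : ℕ → α} (hf : ∀ k, p (f k))
    (hg : ∀ k, p (g k)) (k : ℕ) : p (splice m f g k) := by
  unfold splice
  split_ifs
  exacts [hf k, hg (k - m)]

theorem comp_splice {β : Type*} (h : α → β) (m : ℕ) (f g : ℕ → α) :
    h ∘ splice m f g = splice m (h ∘ f) (h ∘ g) :=
  funext fun _ => apply_ite h _ _ _

theorem IsBadSeq.splice {W U : ℕ → Set X} {N : ℕ → ℕ} (hW : IsBadSeq W) (hN : Monotone N)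
    (hU : IsBadSeq fun k => U k ∩ uncovered W (N k)) : IsBadSeq (splice (N 0) W U) := by
  intro n
  obtain hn | hn := lt_or_ge n (N 0)
  · rw [splice_of_lt W U hn, uncovered_congr fun i hi => splice_of_lt W U (hi.trans hn)]
    exact hW n
  obtain ⟨k, rfl⟩ := Nat.exists_eq_add_of_le hn
  obtain ⟨x, ⟨hxU, hxW⟩, hx⟩ := hU k
  refine ⟨x, by rwa [splice_add], fun i hi => ?_⟩
  obtain hiN | hiN := lt_or_ge i (N 0)
  · rw [splice_of_lt W U hiN]
    exact hxW i (hiN.trans_le (hN k.zero_le))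
  · obtain ⟨j, rfl⟩ := Nat.exists_eq_add_of_le hiN
    have hjk : j < k := Nat.lt_of_add_lt_add_left hi
    rw [splice_add]
    exact fun hxj => hx j hjk ⟨hxj, uncovered_antitone W (hN hjk.le) hxW⟩

/-- The hypothesis `hP` says that `P` is closed in the product of the discrete topologies. -/
theorem exists_lex_minimal_seq {r : α → α → Prop} (hr : WellFounded r) {P : (ℕ → α) → Prop}
    (hP : ∀ g, (∀ n, ∃ f, P f ∧ ∀ m ≤ n, f m = g m) → P g) (hne : ∃ f, P f) :
    ∃ g, P g ∧ ∀ n f, P f → (∀ m < n, f m = g m) → ¬ r (f n) (g n) := by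
  have exists_minimal_term (n : ℕ) (f : {f // P f}) : ∃ g : {f // P f},
      (∀ m < n, g.1 m = f.1 m) ∧ ∀ h, P h → (∀ m < n, h m = f.1 m) → ¬ r (h n) (g.1 n) := by
    obtain ⟨g, hg, hmin⟩ := (InvImage.wf (fun g : {f // P f} => g.1 n) hr).has_min
      {g | ∀ m < n, g.1 m = f.1 m} ⟨f, fun _ _ => rfl⟩
    exact ⟨g, hg, fun h hh => hmin ⟨h, hh⟩⟩
  choose S hS hSmin using exists_minimal_term
  obtain ⟨f₀, hf₀⟩ := hne
  let F : ℕ → {f // P f} := fun n => Nat.rec (S 0 ⟨f₀, hf₀⟩) (fun n f => S (n + 1) f) n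
  have F_stable {m n : ℕ} (hmn : m ≤ n) : (F n).1 m = (F m).1 m := by
    induction n, hmn using Nat.le_induction with
    | base => rfl
    | succ n hmn ih => exact (hS (n + 1) (F n) m (Nat.lt_succ_of_le hmn)).trans ih
  refine ⟨fun n => (F n).1 n, hP _ fun n => ⟨(F n).1, (F n).2, fun m => F_stable⟩, ?_⟩
  rintro (_ | n) f hf hfm
  · exact hSmin 0 _ f hf fun m hm => absurd hm m.not_lt_zero
  · exact hSmin (n + 1) (F n) f hf fun m hm =>
      (hfm m hm).trans (F_stable (Nat.le_of_lt_succ hm)).symm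

/-- A bad sequence of sets, each paired with an index `b` of a family `B b` to which it belongs. -/
def IsRankedBadSeq (B : ι → Set (Set X)) (f : ℕ → ι × Set X) : Prop :=
  (∀ n, (f n).2 ∈ B (f n).1) ∧ IsBadSeq (Prod.snd ∘ f)

/-- A ranked bad sequence whose indices are lexicographically minimal: no ranked bad sequence with
the same first `n` terms has a smaller index at `n`. -/
def IsMinBadSeq [LT ι] (B : ι → Set (Set X)) (f : ℕ → ι × Set X) : Prop :=
  IsRankedBadSeq B f ∧
    ∀ n g, IsRankedBadSeq B g → (∀ m < n, g m = f m) → ¬ (g n).1 < (f n).1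

theorem exists_isMinBadSeq [LT ι] [WellFoundedLT ι] {B : ι → Set (Set X)}
    (hB : ∃ f, IsRankedBadSeq B f) : ∃ f, IsMinBadSeq B f := by
  refine exists_lex_minimal_seq (InvImage.wf Prod.fst wellFounded_lt) (fun g hg => ?_) hB
  refine ⟨fun n => ?_, fun n => ?_⟩ <;> obtain ⟨f, hf, hfg⟩ := hg n
  · rw [← hfg n le_rfl]
    exact hf.1 n
  · have huncovered : uncovered (Prod.snd ∘ f) n = uncovered (Prod.snd ∘ g) n :=
      uncovered_congr fun i hi => congrArg Prod.snd (hfg i hi.le)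
    rw [← huncovered, Function.comp_apply, ← hfg n le_rfl]
    exact hf.2 n

/-- The sets of smaller index than the `n`-th set of `f`, restricted to the points that the first
`n` sets of `f` leave uncovered, for all `n`. -/
def smallerTraces [LT ι] (B : ι → Set (Set X)) (f : ℕ → ι × Set X) : Set (Set X) :=
  {Z | ∃ n, ∃ c < (f n).1, ∃ U ∈ B c, U ∩ uncovered (Prod.snd ∘ f) n = Z}

theorem IsMinBadSeq.noetherianSpace_smallerTraces [LT ι] {B : ι → Set (Set X)}
    {f : ℕ → ι × Set X} (hf : IsMinBadSeq B f) :
    @TopologicalSpace.NoetherianSpace X (TopologicalSpace.generateFrom (smallerTraces B f)) := by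
  refine noetherianSpace_generateFrom_iff.2 fun Z hZ hZbad => ?_
  choose N c hc U hU hUZ using hZ
  obtain rfl := funext hUZ
  obtain ⟨φ, hφ⟩ := (wellQuasiOrdered_le (α := ℕ)).exists_monotone_subseq N
  let g : ℕ → ι × Set X := fun k => (c (φ k), U (φ k))
  have hbad : IsBadSeq (Prod.snd ∘ splice (N (φ 0)) f g) := by
    rw [comp_splice]
    exact hf.1.2.splice (N := N ∘ φ) hφ (hZbad.comp_strictMono φ.strictMono)
  refine hf.2 (N (φ 0)) _ ⟨forall_splice (p := fun q : ι × Set X => q.2 ∈ B q.1) hf.1.1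
    fun k => hU (φ k), hbad⟩ (fun k => splice_of_lt f g) ?_
  have hterm : splice (N (φ 0)) f g (N (φ 0)) = g 0 := splice_add _ 0 f g
  rw [hterm]
  exact hc (φ 0)

end MinimalBadSequences

section TopologyExpanders

variable {X : Type u} {S : TopologicalSpace X → Set (Set X)}

/-- Topology expanders, given by a subbasis `S τ` of the expansion of each topology `τ`. Expansion
is monotone and preserves Noetherian topologies. On a set `H` closed in the expansion of the
discrete topology (the finest expansion), it is local: if `θ` refines `σ` on `H`, then subbasic sets
for `σ` have the same traces on `H` as some subbasic sets for `θ`. -/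
structure IsTopologyExpander (S : TopologicalSpace X → Set (Set X)) : Prop where
  monotone : Monotone fun τ => TopologicalSpace.generateFrom (S τ)
  noetherianSpace : ∀ τ : TopologicalSpace X, @TopologicalSpace.NoetherianSpace X τ →
    @TopologicalSpace.NoetherianSpace X (TopologicalSpace.generateFrom (S τ))
  exists_inter_eq : ∀ (H : Set X), IsClosed[TopologicalSpace.generateFrom (S ⊥)] H →
    ∀ σ θ : TopologicalSpace X, θ.induced (Subtype.val : H → X) ≤ σ.induced Subtype.val →
      ∀ W ∈ S σ, ∃ W' ∈ S θ, W' ∩ H = W ∩ H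

namespace IsTopologyExpander

/-- The monotone map on topologies of a topology expander. -/
def expansion (hS : IsTopologyExpander S) : TopologicalSpace X →o TopologicalSpace X :=
  ⟨fun τ => TopologicalSpace.generateFrom (S τ), hS.monotone⟩

/-- The stages of the transfinite iteration of a topology expander from the coarsest topology. -/
@[reducible]
def stage (hS : IsTopologyExpander S) (a : Ordinal.{u}) : TopologicalSpace X :=
  OrdinalApprox.gfpApprox hS.expansion ⊤ a

theorem isOpen_of_mem (hS : IsTopologyExpander S) {τ : TopologicalSpace X} {W : Set X}
    (hW : W ∈ S τ) : IsOpen[TopologicalSpace.generateFrom (S ⊥)] W :=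
  hS.monotone bot_le W (TopologicalSpace.isOpen_generateFrom_of_mem hW)

variable (hS : IsTopologyExpander S)

theorem stage_eq_generateFrom (a : Ordinal.{u}) :
    hS.stage a = TopologicalSpace.generateFrom (⋃ b < a, S (hS.stage b)) := by
  rw [stage, OrdinalApprox.gfpApprox, top_inf_eq]
  simp only [generateFrom_iUnion]
  rfl

theorem not_isMinBadSeq (f : ℕ → Ordinal.{u} × Set X) :
    ¬ IsMinBadSeq (fun b => S (hS.stage b)) f := by
  intro hf
  let H := uncovered (Prod.snd ∘ f)
  let θ := TopologicalSpace.generateFrom (smallerTraces (fun b => S (hS.stage b)) f)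
  have hH (n : ℕ) : IsClosed[TopologicalSpace.generateFrom (S ⊥)] (H n) :=
    @isClosed_uncovered X (_) _ (fun k => hS.isOpen_of_mem (hf.1.1 k)) n
  have hθ (n : ℕ) : θ.induced (Subtype.val : H n → X) ≤
      (hS.stage (f n).1).induced Subtype.val := by
    rw [hS.stage_eq_generateFrom]
    refine induced_subtypeVal_generateFrom_le fun U hU => ?_
    obtain ⟨c, hc, hUc⟩ := Set.mem_iUnion₂.1 hU
    exact ⟨n, c, hc, U, hUc, rfl⟩
  choose W hW hWf using fun n => hS.exists_inter_eq (H n) (hH n) _ θ (hθ n) (f n).2 (hf.1.1 n)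
  have hWbad : IsBadSeq W := fun n => by
    obtain ⟨x, hx⟩ := hf.1.2 n
    obtain ⟨hxW, hxH⟩ := (hWf n).symm.subset hx
    refine ⟨x, hxW, fun i hi hxi => hxH i hi ?_⟩
    exact ((hWf i).subset ⟨hxi, uncovered_antitone _ hi.le hxH⟩).1
  exact noetherianSpace_generateFrom_iff.1
    (hS.noetherianSpace θ hf.noetherianSpace_smallerTraces) W hW hWbad

theorem noetherianSpace_stage (a : Ordinal.{u}) :
    @TopologicalSpace.NoetherianSpace X (hS.stage a) := by
  rw [hS.stage_eq_generateFrom, noetherianSpace_generateFrom_iff]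
  intro W hW hbad
  have hstage (n : ℕ) : ∃ b, W n ∈ S (hS.stage b) :=
    let ⟨b, _, hb⟩ := Set.mem_iUnion₂.1 (hW n)
    ⟨b, hb⟩
  choose b hb using hstage
  obtain ⟨f, hf⟩ := exists_isMinBadSeq (B := fun b => S (hS.stage b))
    ⟨fun n => (b n, W n), hb, hbad⟩
  exact hS.not_isMinBadSeq f hf

theorem noetherianSpace_gfp : @TopologicalSpace.NoetherianSpace X hS.expansion.gfp := by
  obtain ⟨a, ha⟩ := OrdinalApprox.gfp_mem_range_gfpApprox hS.expansion
  rw [← ha]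
  exact hS.noetherianSpace_stage a

end IsTopologyExpander

end TopologyExpanders

section Support

variable {G : Type u ⥤ Type u}

theorem exists_map_subtypeVal_eq {X : Type u} {x : G.obj X}
    (hx : ∃ f : Over (G.elementsMk X x), IsWeakNormalForm f) {H : Set X}
    (hH : elementSupport G x ⊆ H) : ∃ h : G.obj H, G.map (↾(Subtype.val : H → X)) h = x := by
  obtain ⟨f, hf⟩ := hx
  let g : f.left.1 ⟶ (H : Type u) := ↾fun y => ⟨f.hom.val y, hH ⟨f, hf, y, rfl⟩⟩
  refine ⟨G.map g f.left.2, ?_⟩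
  rw [← ConcreteCategory.comp_apply, ← G.map_comp]
  exact f.hom.2

variable {A : Endofunctor.Algebra G}

theorem substructureUp_of_substructure {S : Set A.a} {a b : A.a} (ha : a ∈ substructureUp G A S)
    (hab : Substructure G A a b) : b ∈ substructureUp G A S :=
  let ⟨c, hc, hca⟩ := ha
  ⟨c, hc, hca.trans hab⟩

theorem substructure_str_of_mem_elementSupport {x : G.obj A.a} {a : A.a}
    (ha : a ∈ elementSupport G x) : Substructure G A a (A.str x) :=
  .single (.inr ⟨x, rfl, ha⟩)

end Support

section Lift

variable {T : TopCat.{u} ⥤ TopCat.{u}} {G : Type u ⥤ Type u} (e : TopLift T G) {X Y : Type u}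

/-- The topology of `T(X, τ)`, transported to the set `G(X)`. -/
@[reducible]
def TopLift.liftTopology (τ : TopologicalSpace X) : TopologicalSpace (G.obj X) :=
  (T.obj (@TopCat.of X τ)).str.induced (e.inv.app (@TopCat.of X τ))

theorem TopLift.induced_map_liftTopology {τ : TopologicalSpace X} {σ : TopologicalSpace Y}
    (i : @TopCat.of X τ ⟶ @TopCat.of Y σ) :
    (e.liftTopology σ).induced (G.map ((forget TopCat.{u}).map i)) =
      ((T.obj (@TopCat.of Y σ)).str.induced (T.map i)).induced (e.inv.app (@TopCat.of X τ)) := by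
  rw [induced_compose, induced_compose]
  congr 1
  ext x
  exact ConcreteCategory.congr_hom (e.inv.naturality i) x

theorem TopLift.liftTopology_le_induced {τ : TopologicalSpace X} {σ : TopologicalSpace Y}
    {f : X → Y} (hf : τ ≤ σ.induced f) :
    e.liftTopology τ ≤ (e.liftTopology σ).induced (G.map (↾f)) := by
  let i : @TopCat.of X τ ⟶ @TopCat.of Y σ :=
    @TopCat.ofHom X Y τ σ (@ContinuousMap.mk X Y τ σ f (continuous_iff_le_induced.2 hf))
  refine (induced_mono (T.map i).hom.continuous.le_induced).trans_eq ?_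
  exact (e.induced_map_liftTopology i).symm

theorem TopLift.liftTopology_induced (hemb : PreservesEmbeddings T) (σ : TopologicalSpace Y)
    {f : X → Y} (hf : f.Injective) :
    e.liftTopology (σ.induced f) = (e.liftTopology σ).induced (G.map (↾f)) := by
  let i : @TopCat.of X (σ.induced f) ⟶ @TopCat.of Y σ :=
    @TopCat.ofHom X Y (σ.induced f) σ
      (@ContinuousMap.mk X Y (σ.induced f) σ f continuous_induced_dom)
  have hi : Topology.IsEmbedding (T.map i) :=
    hemb i (@Topology.IsEmbedding.mk _ _ (_) (_) _ (@Topology.IsInducing.mk _ _ (_) (_) _ rfl) hf)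
  refine Eq.trans ?_ (e.induced_map_liftTopology i).symm
  rw [← hi.eq_induced]

theorem TopLift.exists_isOpen_preimage_map_eq (hemb : PreservesEmbeddings T)
    {σ θ : TopologicalSpace Y} {f : X → Y} (hf : f.Injective) (hle : θ.induced f ≤ σ.induced f)
    {U : Set (G.obj Y)} (hU : IsOpen[e.liftTopology σ] U) :
    ∃ U', IsOpen[e.liftTopology θ] U' ∧ G.map (↾f) ⁻¹' U' = G.map (↾f) ⁻¹' U := by
  have hpre : IsOpen[e.liftTopology (θ.induced f)] (G.map (↾f) ⁻¹' U) :=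
    e.liftTopology_le_induced hle _ ⟨U, hU, rfl⟩
  rwa [e.liftTopology_induced hemb θ hf] at hpre

theorem TopLift.noetherianSpace_liftTopology (hnoeth : PreservesNoetherian T)
    (τ : TopologicalSpace X) (hτ : @TopologicalSpace.NoetherianSpace X τ) :
    @TopologicalSpace.NoetherianSpace (G.obj X) (e.liftTopology τ) := by
  let _ := e.liftTopology τ
  have := hnoeth (@TopCat.of X τ) hτ
  exact Topology.IsInducing.noetherianSpace (α := T.obj (@TopCat.of X τ)) ⟨rfl⟩

end Lift

section DivisibilityExpander

variable {T : TopCat.{u} ⥤ TopCat.{u}} {G : Type u ⥤ Type u} (e : TopLift T G)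
  (A : Endofunctor.Algebra G)

/-- The subbasis by which `divExp e A τ` is defined. -/
def divExpSubbasis (τ : TopologicalSpace A.a) : Set (Set A.a) :=
  {V | ∃ U : Set (T.obj (@TopCat.of A.a τ)),
    IsOpen U ∧ V = substructureUp G A (strImage e A τ U)}

variable {A}

theorem strImage_eq_image (τ : TopologicalSpace A.a) (U : Set (T.obj (@TopCat.of A.a τ))) :
    strImage e A τ U = A.str '' (e.inv.app (@TopCat.of A.a τ) ⁻¹' U) := by
  have hinv : e.hom.app (@TopCat.of A.a τ) '' U = e.inv.app (@TopCat.of A.a τ) ⁻¹' U :=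
    (e.app (@TopCat.of A.a τ)).toEquiv.image_eq_preimage_symm U
  rw [← hinv, Set.image_image]
  rfl

theorem mem_divExpSubbasis_iff {τ : TopologicalSpace A.a} {V : Set A.a} :
    V ∈ divExpSubbasis e A τ ↔
      ∃ U, IsOpen[e.liftTopology τ] U ∧ V = substructureUp G A (A.str '' U) := by
  constructor
  · rintro ⟨U, hU, rfl⟩
    exact ⟨_, ⟨U, hU, rfl⟩, by rw [strImage_eq_image]⟩
  · rintro ⟨_, ⟨U, hU, rfl⟩, rfl⟩
    exact ⟨U, hU, by rw [strImage_eq_image]⟩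

theorem mem_of_isOpen_divExp {τ : TopologicalSpace A.a} {V : Set A.a}
    (hV : IsOpen[divExp e A τ] V) {a b : A.a} (hab : Substructure G A a b) (ha : a ∈ V) :
    b ∈ V := by
  induction hV with
  | basic V hV =>
    obtain ⟨U, -, rfl⟩ := hV
    exact substructureUp_of_substructure ha hab
  | univ => trivial
  | inter V W _ _ ihV ihW => exact ⟨ihV ha.1, ihW ha.2⟩
  | sUnion F _ ih =>
    obtain ⟨V, hVF, haV⟩ := ha
    exact ⟨V, hVF, ih V hVF haV⟩

theorem isBadSeq_of_substructureUp_image_str {U : ℕ → Set (G.obj A.a)}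
    (hU : IsBadSeq fun n => substructureUp G A (A.str '' U n)) : IsBadSeq U := fun n => by
  obtain ⟨b, ⟨_, ⟨x, hx, rfl⟩, hxb⟩, hb⟩ := hU n
  exact ⟨x, hx, fun i hi hxi => hb i hi ⟨A.str x, ⟨x, hxi, rfl⟩, hxb⟩⟩

theorem substructureUp_image_str_inter_subset
    (hG : ∀ x : G.obj A.a, ∃ f : Over (G.elementsMk A.a x), IsWeakNormalForm f) {H : Set A.a}
    (hH : ∀ a b, Substructure G A a b → b ∈ H → a ∈ H) {U U' : Set (G.obj A.a)}
    (hU : G.map (↾(Subtype.val : H → A.a)) ⁻¹' U ⊆ G.map (↾(Subtype.val : H → A.a)) ⁻¹' U') :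
    substructureUp G A (A.str '' U) ∩ H ⊆ substructureUp G A (A.str '' U') ∩ H := by
  rintro b ⟨⟨_, ⟨x, hx, rfl⟩, hxb⟩, hb⟩
  have hsupp : elementSupport G x ⊆ H := fun a ha =>
    hH a b ((substructure_str_of_mem_elementSupport ha).trans hxb) hb
  obtain ⟨h, rfl⟩ := exists_map_subtypeVal_eq (hG x) hsupp
  exact ⟨⟨_, ⟨_, hU hx, rfl⟩, hxb⟩, hb⟩

theorem isTopologyExpander_divExpSubbasis
    (hG : ∀ x : G.obj A.a, ∃ f : Over (G.elementsMk A.a x), IsWeakNormalForm f)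
    (hemb : PreservesEmbeddings T) (hnoeth : PreservesNoetherian T) :
    IsTopologyExpander (divExpSubbasis e A) where
  monotone := divExp_monotone e A
  noetherianSpace τ hτ := by
    refine noetherianSpace_generateFrom_iff.2 fun V hV hbad => ?_
    choose U hU hVU using fun n => (mem_divExpSubbasis_iff e).1 (hV n)
    obtain rfl := funext hVU
    let _ := e.liftTopology τ
    have := e.noetherianSpace_liftTopology hnoeth τ hτ
    exact not_isBadSeq_of_isOpen hU (isBadSeq_of_substructureUp_image_str hbad)
  exists_inter_eq H hH σ θ hle V hV := by
    obtain ⟨U, hU, rfl⟩ := (mem_divExpSubbasis_iff e).1 hV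
    obtain ⟨U', hU', hUU'⟩ :=
      e.exists_isOpen_preimage_map_eq hemb Subtype.val_injective hle hU
    have hlower (a b : A.a) (hab : Substructure G A a b) (hb : b ∈ H) : a ∈ H :=
      by_contra fun ha => mem_of_isOpen_divExp e hH.isOpen_compl hab ha hb
    exact ⟨_, (mem_divExpSubbasis_iff e).2 ⟨U', hU', rfl⟩, Set.Subset.antisymm
      (substructureUp_image_str_inter_subset hG hlower hUU'.subset)
      (substructureUp_image_str_inter_subset hG hlower hUU'.symm.subset)⟩

end DivisibilityExpander

theorem mainTheorem3_general (T : TopCat.{u} ⥤ TopCat.{u}) (G : Type u ⥤ Type u) (e : TopLift T G)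
    (hemb : PreservesEmbeddings T) (hnoeth : PreservesNoetherian T) (A : Endofunctor.Algebra G)
    (hG : ∀ x : G.obj A.a, ∃ f : Over (G.elementsMk A.a x), IsWeakNormalForm f) :
    (divExp e A (divisibilityTopology e A) = divisibilityTopology e A ∧
      ∀ τ : TopologicalSpace A.a, divExp e A τ = τ →
        ∀ U : Set A.a, IsOpen[divisibilityTopology e A] U → IsOpen[τ] U) ∧
    @TopologicalSpace.NoetherianSpace A.a (divisibilityTopology e A) := by
  have hE := isTopologyExpander_divExpSubbasis e hG hemb hnoeth
  exact ⟨⟨hE.expansion.map_gfp, fun τ hτ => hE.expansion.le_gfp hτ.ge⟩, hE.noetherianSpace_gfp⟩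

theorem mainTheorem3 (T : TopCat.{u} ⥤ TopCat.{u}) (G : Type u ⥤ Type u) (e : TopLift T G)
    (hG : IsAnalyticFunctor G) (hemb : PreservesEmbeddings T) (hnoeth : PreservesNoetherian T)
    (A : Endofunctor.Algebra G) (hA : Limits.IsInitial A) :
    (divExp e A (divisibilityTopology e A) = divisibilityTopology e A ∧
      ∀ τ : TopologicalSpace A.a, divExp e A τ = τ →
        ∀ U : Set A.a, IsOpen[divisibilityTopology e A] U → IsOpen[τ] U) ∧
    @TopologicalSpace.NoetherianSpace A.a (divisibilityTopology e A) := by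
  exact mainTheorem3_general T G e hemb hnoeth A fun x => hG.1 (G.elementsMk A.a x)
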